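/- Let $0<\rho\le\frac13$, $I=(0,1)$, $I_\rho=(-\rho,1+\rho)$, and let $n\ge 0$, $k\ge 0$ be integers. **One-dimensional spaces.** For an interval $J=(a,b)$ identify a $1$-form $v\,dx$ with its coefficient $v$, so that $L^2\Lambda^0(J)=L^2\Lambda^1(J)=L^2(J)$. Let $H\Lambda^0(J)$ be the space of $u\in L^2(J)$ with weak derivative $u'\in L^2(J)$, with inner product $\langle u,v\rangle_{L^2}+\langle u',v'\rangle_{L^2}$, let $H\Lambda^1(J)=L^2(J)$, and let $d:H\Lambda^0(J)\to H\Lambda^1(J)$, $du=u'\,dx$. Let $P\Lambda^0=P_3\Lambda^0(I)\subset H\Lambda^0(I)$ be the polynomials of degree at most $3$ and $P\Lambda^1=P_2\Lambda^1(I)\subset H\Lambda^1(I)$ the $1$-forms with polynomial coefficient of degree at most $2$. **One-dimensional quasi-interpolation.** Let $\eta(x)=C\exp\bigl(1/(|x|^2-1)\bigr)$ for $|x|<1$ and $\eta(x)=0$ otherwise, with $\int\eta=1$, and let $\eta_l(x)=\frac1\rho\eta(\frac x\rho)$, $\eta_r(x)=\frac1\rho\eta(\frac{x-1}\rho)$.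 For $y_l\in B_\rho(0)$, $y_r\in B_\rho(1)$ put $$\widetilde{\mathcal N}^0_1(u)=u'(y_l),\quad \widetilde{\mathcal N}^0_2(u)=u'(y_r),\quad \widetilde{\mathcal N}^0_3(u)=u(y_r)-u(y_l),\quad \widetilde{\mathcal N}^0_4(u)=u(y_r)+u(y_l),$$ $$\widetilde{\mathcal N}^1_1(v)=v(y_l),\quad \widetilde{\mathcal N}^1_2(v)=v(y_r),\quad \widetilde{\mathcal N}^1_3(v)=\int_{y_l}^{y_r}v\,dx ,$$ and let $$\overline{\mathcal N}^j_m(u)=\int_{B_\rho(0)}\int_{B_\rho(1)}\eta_l(y_l)\,\eta_r(y_r)\,\widetilde{\mathcal N}^j_m(u)\,dy_r\,dy_l ,$$ for $u\in C^1(\overline{I_\rho})$ if $j=0$ and $u\in C^0(\overline{I_\rho})$ if $j=1$. These functionals extend uniquely to bounded functionals on $L^2(I_\rho)$, denoted in the same way. With $$\phi^0_1=x-2x^2+x^3,\quad \phi^0_2=-x^2+x^3,\quad \phi^0_3=-\tfrac12+3x^2-2x^3,\quad \phi^0_4=\tfrac12,$$ $$\phi^1_1=1-4x+3x^2,\quad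 \phi^1_2=-2x+3x^2,\quad \phi^1_3=6x-6x^2$$ define $\Pi_0:L^2\Lambda^0(I_\rho)\to P\Lambda^0$, $\Pi_0u=\sum_{m=1}^4\overline{\mathcal N}^0_m(u)\,\phi^0_m$, and $\Pi_1:L^2\Lambda^1(I_\rho)\to P\Lambda^1$, $\Pi_1v=\sum_{m=1}^3\overline{\mathcal N}^1_m(v)\,\phi^1_m$. Extend $\Pi_0$ by zero to $1$-forms and $\Pi_1$ by zero to $0$-forms. **Tensor products.** Let $\otimes$ denote the Hilbert space tensor product, i.e. the completion of the algebraic tensor product with respect to the inner product determined by $\langle \otimes_j u_j,\otimes_j v_j\rangle=\prod_j\langle u_j,v_j\rangle$; tensor products of bounded operators are extended from rank-one elements by linearity and density. Let $\chi_k=\{\mathbf i\in\{0,1\}^n:\sum_j i_j=k\}$ and $$(H\Lambda^{\otimes n})^k=\bigoplus_{\mathbf i\in\chi_k}H\Lambda^{i_1}(I_\rho)\otimes\cdots\otimes H\Lambda^{i_n}(I_\rho),$$ and define $(L^2\Lambda^{\otimes n})^k$ (on $I_\rho$) and $(P\Lambda^{\otimes n})^k$ (on $I$) in the same way. The exterior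 derivative $d^k$ on $(H\Lambda^{\otimes n})^k$ and on $(P\Lambda^{\otimes n})^k$ is the bounded operator with $$d^k(u_1\otimes\cdots\otimes u_n)=\sum_{j=1}^n(-1)^{i_1+\cdots+i_{j-1}}\,u_1\otimes\cdots\otimes du_j\otimes\cdots\otimes u_n$$ for $u_1\otimes\cdots\otimes u_n$ in the summand of $\mathbf i\in\chi_k$ (the terms with $i_j=1$ vanish). Let $$\Pi^k=\sum_{\mathbf i\in\chi_k}\Pi_{i_1}\otimes\cdots\otimes\Pi_{i_n}:(L^2\Lambda^{\otimes n})^k\to(P\Lambda^{\otimes n})^k ,$$ which is applied to elements of $(H\Lambda^{\otimes n})^k$ through the natural map $(H\Lambda^{\otimes n})^k\to(L^2\Lambda^{\otimes n})^k$ induced by the inclusions $H\Lambda^i(I_\rho)\subset L^2\Lambda^i(I_\rho)$. **Lemma.** The operators $\Pi^k$ commute with the exterior derivative: for every $u\in(H\Lambda^{\otimes n})^k$, $$\Pi^{k+1}(d^ku)=d^k\,\Pi^ku .$$ -/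

import Mathlib

open MeasureTheory Set
open scoped ContDiff

noncomputable section

namespace QuasiInterp

/-! ### Hilbert tensor products of finitely many inner product spaces -/

section HilbertTensor

variable {n : ℕ}

/-- The algebraic tensor product `E 0 ⊗ ⋯ ⊗ E (n-1)`, to be equipped with the inner product
`⟪u₁ ⊗ ⋯ ⊗ uₙ, v₁ ⊗ ⋯ ⊗ vₙ⟫ = ∏ ⟪uⱼ, vⱼ⟫`. -/
def AlgTensor (E : Fin n → Type) [∀ j, NormedAddCommGroup (E j)]
    [∀ j, InnerProductSpace ℝ (E j)] : Type :=
  PiTensorProduct ℝ E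

variable (E F G : Fin n → Type)
  [∀ j, NormedAddCommGroup (E j)] [∀ j, InnerProductSpace ℝ (E j)]
  [∀ j, NormedAddCommGroup (F j)] [∀ j, InnerProductSpace ℝ (F j)]
  [∀ j, NormedAddCommGroup (G j)] [∀ j, InnerProductSpace ℝ (G j)]

instance : AddCommGroup (AlgTensor E) := inferInstanceAs (AddCommGroup (PiTensorProduct ℝ E))

instance : Module ℝ (AlgTensor E) :=
  (PiTensorProduct.instModule : Module ℝ (PiTensorProduct ℝ E))

variable {E F G}

/-- The algebraic rank-one tensor `u₁ ⊗ ⋯ ⊗ uₙ`. -/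
def AlgTensor.pure (u : ∀ j, E j) : AlgTensor E := PiTensorProduct.tprod ℝ u

/-- Every element is a finite linear combination of rank-one tensors. -/
theorem AlgTensor.exists_sum (t : AlgTensor E) :
    ∃ (m : ℕ) (c : Fin m → ℝ) (x : Fin m → ∀ j, E j), t = ∑ a, c a • AlgTensor.pure (x a) := by
  have key : ∀ t : PiTensorProduct ℝ E, ∃ (m : ℕ) (c : Fin m → ℝ) (x : Fin m → ∀ j, E j),
      t = ∑ a, c a • PiTensorProduct.tprod ℝ (x a) := by
    intro t
    have ht : t ∈ Submodule.span ℝ (Set.range (PiTensorProduct.tprod ℝ (s := E))) := by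
      rw [PiTensorProduct.span_tprod_eq_top]
      trivial
    obtain ⟨m, c, g, hg⟩ := Submodule.mem_span_set'.mp ht
    choose x hx using fun a => (g a).2
    refine ⟨m, c, x, ?_⟩
    rw [← hg]
    exact Finset.sum_congr rfl fun a _ => by rw [hx a]
  exact key t

variable (E) in
/-- The bilinear form with `(⊗ uⱼ, ⊗ vⱼ) ↦ ∏ ⟪uⱼ, vⱼ⟫`. -/
def AlgTensor.form : AlgTensor E →ₗ[ℝ] AlgTensor E →ₗ[ℝ] ℝ :=
  let f : PiTensorProduct ℝ E →ₗ[ℝ] PiTensorProduct ℝ E →ₗ[ℝ] ℝ :=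
    LinearMap.compr₂ (PiTensorProduct.map₂ (fun j => innerₗ (E j)))
      (PiTensorProduct.lift (MultilinearMap.mkPiAlgebra ℝ (Fin n) ℝ))
  f

theorem AlgTensor.form_pure (u v : ∀ j, E j) :
    AlgTensor.form E (AlgTensor.pure u) (AlgTensor.pure v) = ∏ j, inner ℝ (u j) (v j) := by
  have h : PiTensorProduct.lift (MultilinearMap.mkPiAlgebra ℝ (Fin n) ℝ)
      (PiTensorProduct.map₂ (fun j => innerₗ (E j)) (PiTensorProduct.tprod ℝ u)
        (PiTensorProduct.tprod ℝ v)) = ∏ j, inner ℝ (u j) (v j) := by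
    rw [PiTensorProduct.map₂_tprod_tprod, PiTensorProduct.lift.tprod]
    simp
  exact h

theorem AlgTensor.form_sum {m m' : ℕ} (c : Fin m → ℝ) (x : Fin m → ∀ j, E j)
    (c' : Fin m' → ℝ) (x' : Fin m' → ∀ j, E j) :
    AlgTensor.form E (∑ a, c a • AlgTensor.pure (x a)) (∑ a, c' a • AlgTensor.pure (x' a))
      = ∑ a, ∑ b, c a * c' b * ∏ j, inner ℝ (x a j) (x' b j) := by
  simp only [map_sum, map_smul, LinearMap.sum_apply, LinearMap.smul_apply, smul_eq_mul,
    AlgTensor.form_pure, Finset.mul_sum]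
  rw [Finset.sum_comm]
  refine Finset.sum_congr rfl fun a _ => Finset.sum_congr rfl fun b _ => by ring

theorem AlgTensor.form_symm (s t : AlgTensor E) :
    AlgTensor.form E s t = AlgTensor.form E t s := by
  obtain ⟨m, c, x, rfl⟩ := AlgTensor.exists_sum s
  obtain ⟨m', c', x', rfl⟩ := AlgTensor.exists_sum t
  rw [AlgTensor.form_sum, AlgTensor.form_sum, Finset.sum_comm]
  refine Finset.sum_congr rfl fun a _ => Finset.sum_congr rfl fun b _ => ?_
  simp only [real_inner_comm]
  ring

/-- Entrywise products of positive semidefinite matrices are monotone. -/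
theorem posSemidef_prod_sub {m : ℕ} (s : Finset (Fin n)) (A B : Fin n → Matrix (Fin m) (Fin m) ℝ)
    (hB : ∀ j, (B j).PosSemidef) (hAB : ∀ j, (A j - B j).PosSemidef) :
    (Matrix.of fun a b => ∏ j ∈ s, B j a b).PosSemidef ∧
      (Matrix.of fun a b => ∏ j ∈ s, A j a b - ∏ j ∈ s, B j a b).PosSemidef := by
  classical
  induction s using Finset.induction_on with
  | empty =>
    constructor
    · have h := Matrix.posSemidef_vecMulVec_self_star (fun _ : Fin m => (1 : ℝ))
      convert h using 1
      ext a b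
      simp [Matrix.vecMulVec]
    · convert Matrix.PosSemidef.zero (n := Fin m) (R := ℝ) using 1
      ext a b
      simp
  | insert i s hi ih =>
    constructor
    · have h := (hB i).hadamard ih.1
      refine (congrArg Matrix.PosSemidef ?_).mpr h
      ext a b
      simp [Finset.prod_insert hi, Matrix.hadamard]
    · have h := ((hAB i).hadamard (ih.1.add ih.2)).add ((hB i).hadamard ih.2)
      refine (congrArg Matrix.PosSemidef ?_).mpr h
      ext a b
      simp [Finset.prod_insert hi, Matrix.hadamard]
      ring

theorem sum_mul_nonneg {m : ℕ} (M : Matrix (Fin m) (Fin m) ℝ) (hM : M.PosSemidef)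
    (c : Fin m → ℝ) : 0 ≤ ∑ a, ∑ b, c a * c b * M a b := by
  have h := hM.dotProduct_mulVec_nonneg c
  refine h.trans_eq ?_
  simp only [dotProduct, Matrix.mulVec, Finset.mul_sum, star_trivial]
  refine Finset.sum_congr rfl fun a _ => Finset.sum_congr rfl fun b _ => by ring

theorem AlgTensor.form_nonneg (t : AlgTensor E) : 0 ≤ AlgTensor.form E t t := by
  obtain ⟨m, c, x, rfl⟩ := AlgTensor.exists_sum t
  rw [AlgTensor.form_sum]
  have h := (posSemidef_prod_sub Finset.univ (fun j => Matrix.gram ℝ fun a => x a j)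
    (fun j => Matrix.gram ℝ fun a => x a j) (fun j => Matrix.posSemidef_gram ℝ _)
    (fun j => by simpa using Matrix.PosSemidef.zero)).1
  simpa [Matrix.gram] using sum_mul_nonneg _ h c

variable (E) in
/-- The inner product on the algebraic tensor product. -/
@[reducible]
def AlgTensor.core : PreInnerProductSpace.Core ℝ (AlgTensor E) where
  inner s t := AlgTensor.form E s t
  conj_inner_symm s t := by simpa using AlgTensor.form_symm t s
  re_inner_nonneg t := by simpa using AlgTensor.form_nonneg t
  add_left s t r := by simp
  smul_left s t r := by simp

instance : SeminormedAddCommGroup (AlgTensor E) :=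
  @InnerProductSpace.Core.toSeminormedAddCommGroup ℝ _ _ _ _ (AlgTensor.core E)

instance : InnerProductSpace ℝ (AlgTensor E) := InnerProductSpace.ofCore (AlgTensor.core E)

theorem AlgTensor.inner_pure (u v : ∀ j, E j) :
    inner ℝ (AlgTensor.pure u) (AlgTensor.pure v) = ∏ j, inner ℝ (u j) (v j) :=
  AlgTensor.form_pure u v

/-- The algebraic tensor product of linear operators. -/
def AlgTensor.mapₗ (T : ∀ j, E j →L[ℝ] F j) : AlgTensor E →ₗ[ℝ] AlgTensor F :=
  PiTensorProduct.map fun j => (T j : E j →ₗ[ℝ] F j)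

theorem AlgTensor.mapₗ_pure (T : ∀ j, E j →L[ℝ] F j) (u : ∀ j, E j) :
    AlgTensor.mapₗ T (AlgTensor.pure u) = AlgTensor.pure fun j => T j (u j) :=
  PiTensorProduct.map_tprod _ _

theorem AlgTensor.norm_mapₗ_le (T : ∀ j, E j →L[ℝ] F j) (t : AlgTensor E) :
    ‖AlgTensor.mapₗ T t‖ ≤ (∏ j, ‖T j‖) * ‖t‖ := by
  have hp : 0 ≤ ∏ j, ‖T j‖ := Finset.prod_nonneg fun j _ => norm_nonneg _
  refine le_of_sq_le_sq ?_ (mul_nonneg hp (norm_nonneg _))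
  rw [mul_pow, ← real_inner_self_eq_norm_sq, ← real_inner_self_eq_norm_sq]
  change AlgTensor.form F _ _ ≤ _ * AlgTensor.form E _ _
  obtain ⟨m, c, x, rfl⟩ := AlgTensor.exists_sum t
  have e : AlgTensor.mapₗ T (∑ a, c a • AlgTensor.pure (x a))
      = ∑ a, c a • AlgTensor.pure (fun j => T j (x a j)) := by
    simp only [map_sum, map_smul, AlgTensor.mapₗ_pure]
  rw [e, AlgTensor.form_sum, AlgTensor.form_sum]
  have h := (posSemidef_prod_sub Finset.univ
    (fun j => ‖T j‖ ^ 2 • Matrix.gram ℝ fun a => x a j)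
    (fun j => Matrix.gram ℝ fun a => T j (x a j)) (fun j => Matrix.posSemidef_gram ℝ _)
    (fun j => Matrix.posSemidef_opNorm_smul_gram_sub_gram _ _)).2
  have h' := sum_mul_nonneg _ h c
  rw [← sub_nonneg]
  convert h' using 1
  simp only [Matrix.of_apply, Matrix.smul_apply, Matrix.gram_apply, smul_eq_mul,
    Finset.prod_mul_distrib, mul_sub, Finset.sum_sub_distrib, Finset.mul_sum, Finset.prod_pow]
  congr 1
  refine Finset.sum_congr rfl fun a _ => Finset.sum_congr rfl fun b _ => by ring

/-- The algebraic tensor product of bounded operators, as a bounded operator. -/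
def AlgTensor.map (T : ∀ j, E j →L[ℝ] F j) : AlgTensor E →L[ℝ] AlgTensor F :=
  (AlgTensor.mapₗ T).mkContinuous (∏ j, ‖T j‖) (AlgTensor.norm_mapₗ_le T)

variable (E) in
/-- The Hilbert tensor product: the completion of the algebraic tensor product with respect to
the inner product `⟪u₁ ⊗ ⋯ ⊗ uₙ, v₁ ⊗ ⋯ ⊗ vₙ⟫ = ∏ ⟪uⱼ, vⱼ⟫`. (Definiteness of this inner product
is not needed for the construction, since the completion is always separated.) -/
def HilbertTensor : Type := UniformSpace.Completion (AlgTensor E)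

instance : NormedAddCommGroup (HilbertTensor E) :=
  inferInstanceAs (NormedAddCommGroup (UniformSpace.Completion (AlgTensor E)))

instance : InnerProductSpace ℝ (HilbertTensor E) :=
  inferInstanceAs (InnerProductSpace ℝ (UniformSpace.Completion (AlgTensor E)))

instance : CompleteSpace (HilbertTensor E) :=
  inferInstanceAs (CompleteSpace (UniformSpace.Completion (AlgTensor E)))

/-- The rank-one element `u₁ ⊗ ⋯ ⊗ uₙ` of the Hilbert tensor product. -/
def HilbertTensor.pure (u : ∀ j, E j) : HilbertTensor E :=
  ((AlgTensor.pure u : AlgTensor E) : UniformSpace.Completion (AlgTensor E))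

/-- The tensor product `T₁ ⊗ ⋯ ⊗ Tₙ` of bounded operators, extended from rank-one elements by
linearity and density. -/
def HilbertTensor.map (T : ∀ j, E j →L[ℝ] F j) : HilbertTensor E →L[ℝ] HilbertTensor F :=
  (AlgTensor.map T).completion

theorem HilbertTensor.inner_pure (u v : ∀ j, E j) :
    inner ℝ (HilbertTensor.pure u) (HilbertTensor.pure v) = ∏ j, inner ℝ (u j) (v j) :=
  (UniformSpace.Completion.inner_coe (𝕜 := ℝ) (AlgTensor.pure u) (AlgTensor.pure v)).trans
    (AlgTensor.inner_pure u v)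

theorem HilbertTensor.map_pure (T : ∀ j, E j →L[ℝ] F j) (u : ∀ j, E j) :
    HilbertTensor.map T (HilbertTensor.pure u) = HilbertTensor.pure fun j => T j (u j) := by
  have h := ContinuousLinearMap.completion_apply_coe (AlgTensor.map T) (AlgTensor.pure u)
  exact h.trans (congrArg _ (AlgTensor.mapₗ_pure T u))

/-- Bounded operators on a Hilbert tensor product are determined by their values on rank-one
elements. -/
theorem HilbertTensor.ext {H : Type} [NormedAddCommGroup H] [NormedSpace ℝ H]
    {S T : HilbertTensor E →L[ℝ] H}
    (h : ∀ u, S (HilbertTensor.pure u) = T (HilbertTensor.pure u)) : S = T := by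
  refine ContinuousLinearMap.ext fun x => ?_
  refine UniformSpace.Completion.induction_on (p := fun x => S x = T x) x
    (isClosed_eq S.continuous T.continuous) fun t => ?_
  obtain ⟨m, c, x, rfl⟩ := AlgTensor.exists_sum t
  let ι : AlgTensor E →L[ℝ] HilbertTensor E := UniformSpace.Completion.toComplL
  have e : ι (∑ a, c a • AlgTensor.pure (x a)) = ∑ a, c a • HilbertTensor.pure (x a) := by
    rw [map_sum]
    exact Finset.sum_congr rfl fun a _ => map_smul ι _ _
  change S (ι _) = T (ι _)
  rw [e, map_sum, map_sum]
  simp only [map_smul, h]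

end HilbertTensor

/-! ### Differential forms on an interval -/

section OneDim

/-- The space `L²(a, b)` of coefficient functions of square-integrable forms. -/
abbrev L2 (a b : ℝ) : Type := Lp ℝ 2 (volume.restrict (Ioo a b))

/-- `w` is the weak derivative of `u` on `(a, b)`. -/
def HasWeakDeriv (a b : ℝ) (u w : L2 a b) : Prop :=
  ∀ φ : ℝ → ℝ, ContDiff ℝ ∞ φ → HasCompactSupport φ → tsupport φ ⊆ Ioo a b →
    ∫ x in Ioo a b, u x * deriv φ x = -∫ x in Ioo a b, w x * φ x

theorem memLp_of_continuous (a b : ℝ) {g : ℝ → ℝ} (hg : Continuous g) (p : ENNReal) :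
    MemLp g p (volume.restrict (Ioo a b)) := by
  obtain ⟨C, hC⟩ := (isCompact_Icc (a := a) (b := b)).exists_bound_of_continuousOn hg.continuousOn
  refine MemLp.of_bound hg.aestronglyMeasurable C ?_
  exact (ae_restrict_mem measurableSet_Ioo).mono fun x hx => hC x (Ioo_subset_Icc_self hx)

theorem integrable_mul_continuous (a b : ℝ) (u : L2 a b) {g : ℝ → ℝ} (hg : Continuous g) :
    Integrable (fun x => u x * g x) (volume.restrict (Ioo a b)) :=
  (Lp.memLp u).integrable_mul (memLp_of_continuous a b hg 2)

theorem HasWeakDeriv.add {a b : ℝ} {u w u' w' : L2 a b} (h : HasWeakDeriv a b u w)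
    (h' : HasWeakDeriv a b u' w') : HasWeakDeriv a b (u + u') (w + w') := by
  intro φ h1 h2 h3
  have hd : Continuous (deriv φ) := h1.continuous_deriv (by simp)
  have e1 : ∫ x in Ioo a b, (u + u' : L2 a b) x * deriv φ x
      = ∫ x in Ioo a b, (u x * deriv φ x + u' x * deriv φ x) :=
    integral_congr_ae ((Lp.coeFn_add u u').mono fun x hx => by simp only [hx, Pi.add_apply, add_mul])
  have e2 : ∫ x in Ioo a b, (w + w' : L2 a b) x * φ x
      = ∫ x in Ioo a b, (w x * φ x + w' x * φ x) :=
    integral_congr_ae ((Lp.coeFn_add w w').mono fun x hx => by simp only [hx, Pi.add_apply, add_mul])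
  rw [e1, e2, integral_add (integrable_mul_continuous a b _ hd) (integrable_mul_continuous a b _ hd),
    integral_add (integrable_mul_continuous a b _ h1.continuous)
      (integrable_mul_continuous a b _ h1.continuous), h φ h1 h2 h3, h' φ h1 h2 h3]
  ring

theorem HasWeakDeriv.smul {a b : ℝ} {u w : L2 a b} (c : ℝ) (h : HasWeakDeriv a b u w) :
    HasWeakDeriv a b (c • u) (c • w) := by
  intro φ h1 h2 h3
  have e1 : ∫ x in Ioo a b, (c • u : L2 a b) x * deriv φ x
      = ∫ x in Ioo a b, c * (u x * deriv φ x) :=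
    integral_congr_ae ((Lp.coeFn_smul c u).mono fun x hx => by
      simp only [hx, Pi.smul_apply, smul_eq_mul, mul_assoc])
  have e2 : ∫ x in Ioo a b, (c • w : L2 a b) x * φ x = ∫ x in Ioo a b, c * (w x * φ x) :=
    integral_congr_ae ((Lp.coeFn_smul c w).mono fun x hx => by
      simp only [hx, Pi.smul_apply, smul_eq_mul, mul_assoc])
  rw [e1, e2, integral_const_mul, integral_const_mul, h φ h1 h2 h3]
  ring

theorem HasWeakDeriv.zero {a b : ℝ} : HasWeakDeriv a b 0 0 := by
  intro φ h1 h2 h3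
  have h0 := Lp.coeFn_zero ℝ 2 (volume.restrict (Ioo a b))
  have e1 : ∫ x in Ioo a b, (0 : L2 a b) x * deriv φ x = ∫ x in Ioo a b, (0 : ℝ) :=
    integral_congr_ae (h0.mono fun x hx => by
      change (0 : L2 a b) x * deriv φ x = 0
      rw [show (0 : L2 a b) x = 0 from hx, zero_mul])
  have e2 : ∫ x in Ioo a b, (0 : L2 a b) x * φ x = ∫ x in Ioo a b, (0 : ℝ) :=
    integral_congr_ae (h0.mono fun x hx => by
      change (0 : L2 a b) x * φ x = 0
      rw [show (0 : L2 a b) x = 0 from hx, zero_mul])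
  rw [e1, e2]
  simp

/-- The space `HΛᵏ(a, b)`, `k = 0, 1`, of square-integrable `k`-forms `u` with square-integrable
exterior derivative `du`. The form `u` is recorded by the pair of the coefficient functions of `u`
and of `du`, so that the inner product is `⟪u, v⟫ + ⟪du, dv⟫`. A `1`-form `u dx` on the interval
has `d(u dx) = 0`. -/
def HForm (a b : ℝ) (k : Fin 2) : Submodule ℝ (WithLp 2 (L2 a b × L2 a b)) :=
  match k with
  | 0 =>
    { carrier := {p | HasWeakDeriv a b p.fst p.snd}
      add_mem' := fun h h' => HasWeakDeriv.add h h'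
      zero_mem' := HasWeakDeriv.zero
      smul_mem' := fun c _ h => HasWeakDeriv.smul c h }
  | 1 =>
    { carrier := {p | p.snd = 0}
      add_mem' := fun {p q} (h : p.snd = 0) (h' : q.snd = 0) => by
        simp [h, h']
      zero_mem' := rfl
      smul_mem' := fun c p (h : p.snd = 0) => by simp [h] }

/-- The inclusion `HΛᵏ(a, b) ⊆ L²Λᵏ(a, b)`. -/
def HForm.incl (a b : ℝ) (k : Fin 2) : HForm a b k →L[ℝ] L2 a b :=
  (WithLp.fstL 2 ℝ (L2 a b) (L2 a b)).comp (HForm a b k).subtypeL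

theorem norm_snd_zero_le {a b : ℝ} (p : WithLp 2 (L2 a b × L2 a b)) :
    ‖(WithLp.toLp 2 (p.snd, 0) : WithLp 2 (L2 a b × L2 a b))‖ ≤ 1 * ‖p‖ := by
  rw [one_mul]
  refine le_of_sq_le_sq ?_ (norm_nonneg _)
  rw [WithLp.prod_norm_sq_eq_of_L2, WithLp.prod_norm_sq_eq_of_L2]
  change ‖p.snd‖ ^ 2 + ‖(0 : L2 a b)‖ ^ 2 ≤ _
  rw [norm_zero]
  nlinarith [sq_nonneg ‖p.fst‖]

/-- The exterior derivative `d : HΛ⁰(a, b) → HΛ¹(a, b)`, `du = u' dx`. -/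
def HForm.d (a b : ℝ) : HForm a b 0 →L[ℝ] HForm a b 1 :=
  LinearMap.mkContinuous
    { toFun := fun u => ⟨WithLp.toLp 2 ((u : WithLp 2 (L2 a b × L2 a b)).snd, 0), rfl⟩
      map_add' := fun u v => by
        apply Subtype.ext
        apply WithLp.ofLp_injective 2
        ext1 <;> simp
      map_smul' := fun c u => by
        apply Subtype.ext
        apply WithLp.ofLp_injective 2
        ext1 <;> simp }
    1 (fun u => norm_snd_zero_le (u : WithLp 2 (L2 a b × L2 a b)))

/-! ### Polynomial forms -/

/-- The class in `L²(a, b)` of a continuous function. -/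
def toL2 (a b : ℝ) : C(ℝ, ℝ) →ₗ[ℝ] L2 a b where
  toFun g := (memLp_of_continuous a b g.continuous 2).toLp g
  map_add' _ _ := rfl
  map_smul' _ _ := rfl

theorem coeFn_toL2 (a b : ℝ) (g : C(ℝ, ℝ)) : toL2 a b g =ᵐ[volume.restrict (Ioo a b)] g :=
  MemLp.coeFn_toLp (memLp_of_continuous a b g.continuous 2)

/-- A polynomial as an element of `L²(a, b)`. -/
def polyL2 (a b : ℝ) : Polynomial ℝ →ₗ[ℝ] L2 a b :=
  (toL2 a b) ∘ₗ (Polynomial.toContinuousMapAlgHom (R := ℝ)).toLinearMap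

theorem coeFn_polyL2 (a b : ℝ) (p : Polynomial ℝ) :
    polyL2 a b p =ᵐ[volume.restrict (Ioo a b)] fun x => p.eval x :=
  coeFn_toL2 a b (Polynomial.toContinuousMapAlgHom p)

theorem hasWeakDeriv_poly (a b : ℝ) (p : Polynomial ℝ) :
    HasWeakDeriv a b (polyL2 a b p) (polyL2 a b (Polynomial.derivative p)) := by
  intro φ h1 h2 h3
  have e1 : ∫ x in Ioo a b, polyL2 a b p x * deriv φ x
      = ∫ x in Ioo a b, p.eval x * deriv φ x :=
    integral_congr_ae ((coeFn_polyL2 a b p).mono fun x hx => by simp only [hx])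
  have e2 : ∫ x in Ioo a b, polyL2 a b (Polynomial.derivative p) x * φ x
      = ∫ x in Ioo a b, (Polynomial.derivative p).eval x * φ x :=
    integral_congr_ae ((coeFn_polyL2 a b (Polynomial.derivative p)).mono fun x hx => by simp only [hx])
  rw [e1, e2]
  rcases le_or_gt b a with hab | hab
  · simp [Ioo_eq_empty (not_lt.mpr hab)]
  have hd : Continuous (deriv φ) := h1.continuous_deriv (by simp)
  have ha : φ a = 0 := image_eq_zero_of_notMem_tsupport fun h => (lt_irrefl a (h3 h).1)
  have hb : φ b = 0 := image_eq_zero_of_notMem_tsupport fun h => (lt_irrefl b (h3 h).2)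
  rw [← integral_Ioc_eq_integral_Ioo, ← integral_Ioc_eq_integral_Ioo,
    ← intervalIntegral.integral_of_le hab.le, ← intervalIntegral.integral_of_le hab.le,
    intervalIntegral.integral_mul_deriv_eq_deriv_mul (fun x _ => p.hasDerivAt x)
      (fun x _ => (h1.differentiable (by simp) x).hasDerivAt)
      ((Polynomial.derivative p).continuous.intervalIntegrable _ _) (hd.intervalIntegrable _ _),
    ha, hb]
  simp

/-- A polynomial `k`-form `p` (or `p dx`) as an element of `HΛᵏ(a, b)`. -/
def polyForm (a b : ℝ) (k : Fin 2) : Polynomial ℝ →ₗ[ℝ] HForm a b k :=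
  match k with
  | 0 =>
    { toFun := fun p => ⟨WithLp.toLp 2 (polyL2 a b p, polyL2 a b (Polynomial.derivative p)),
        hasWeakDeriv_poly a b p⟩
      map_add' := fun p q => by
        apply Subtype.ext
        apply WithLp.ofLp_injective 2
        ext1 <;> simp
      map_smul' := fun c p => by
        apply Subtype.ext
        apply WithLp.ofLp_injective 2
        ext1 <;> simp }
  | 1 =>
    { toFun := fun p => ⟨WithLp.toLp 2 (polyL2 a b p, 0), rfl⟩
      map_add' := fun p q => by
        apply Subtype.ext
        apply WithLp.ofLp_injective 2
        ext1 <;> simp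
      map_smul' := fun c p => by
        apply Subtype.ext
        apply WithLp.ofLp_injective 2
        ext1 <;> simp }

theorem HForm.d_polyForm (a b : ℝ) (p : Polynomial ℝ) :
    HForm.d a b (polyForm a b 0 p) = polyForm a b 1 (Polynomial.derivative p) := rfl

/-- The finite element spaces `P₃Λ⁰(I)` and `P₂Λ¹(I)` on the reference interval `I = (0, 1)`,
as subspaces of `HΛᵏ(I)`; a polynomial is determined by its class in `L²(I)`. -/
def PForm (k : Fin 2) : Submodule ℝ (HForm 0 1 k) :=
  (Polynomial.degreeLE ℝ ((3 - (k : ℕ) : ℕ) : WithBot ℕ)).map (polyForm 0 1 k)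

theorem HForm.d_mem_PForm (u : PForm 0) : HForm.d 0 1 (u : HForm 0 1 0) ∈ PForm 1 := by
  obtain ⟨u, p, hp, rfl⟩ := u
  refine ⟨Polynomial.derivative p, ?_, HForm.d_polyForm 0 1 p⟩
  have hp' : p ∈ Polynomial.degreeLE ℝ ((3 : ℕ) : WithBot ℕ) := hp
  change Polynomial.derivative p ∈ Polynomial.degreeLE ℝ ((2 : ℕ) : WithBot ℕ)
  rw [Polynomial.mem_degreeLE, ← Polynomial.natDegree_le_iff_degree_le] at hp' ⊢
  exact (Polynomial.natDegree_derivative_le p).trans (by omega)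

/-- The exterior derivative `d : P₃Λ⁰(I) → P₂Λ¹(I)`. -/
def PForm.d : PForm 0 →L[ℝ] PForm 1 :=
  ((HForm.d 0 1).comp (PForm 0).subtypeL).codRestrict (PForm 1) HForm.d_mem_PForm

open Polynomial in
/-- The basis functions of `P₃Λ⁰(I)`. -/
def phi0 : Fin 4 → Polynomial ℝ :=
  ![X - C 2 * X ^ 2 + X ^ 3, -X ^ 2 + X ^ 3, C (-1 / 2) + C 3 * X ^ 2 - C 2 * X ^ 3, C (1 / 2)]

open Polynomial in
/-- The basis functions of `P₂Λ¹(I)`. -/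
def phi1 : Fin 3 → Polynomial ℝ :=
  ![1 - C 4 * X + C 3 * X ^ 2, -C 2 * X + C 3 * X ^ 2, C 6 * X - C 6 * X ^ 2]

theorem phi0_mem (i : Fin 4) : polyForm 0 1 0 (phi0 i) ∈ PForm 0 := by
  refine ⟨phi0 i, ?_, rfl⟩
  change phi0 i ∈ Polynomial.degreeLE ℝ ((3 : ℕ) : WithBot ℕ)
  rw [Polynomial.mem_degreeLE]
  fin_cases i <;> simp only [phi0] <;> simp <;> compute_degree

theorem phi1_mem (i : Fin 3) : polyForm 0 1 1 (phi1 i) ∈ PForm 1 := by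
  refine ⟨phi1 i, ?_, rfl⟩
  change phi1 i ∈ Polynomial.degreeLE ℝ ((2 : ℕ) : WithBot ℕ)
  rw [Polynomial.mem_degreeLE]
  fin_cases i <;> simp only [phi1] <;> simp <;> compute_degree

end OneDim

/-! ### Weighted node functionals -/

section Nodes

/-- The unnormalized standard mollifier. -/
def bump (x : ℝ) : ℝ := if |x| < 1 then Real.exp (1 / (|x| ^ 2 - 1)) else 0

/-- The standard mollifier `η`, with integral `1`. -/
def mollifier (x : ℝ) : ℝ := (∫ y, bump y)⁻¹ * bump x

/-- The cut-off function `η_l` at the left end point. -/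
def etaL (ρ x : ℝ) : ℝ := 1 / ρ * mollifier (x / ρ)

/-- The cut-off function `η_r` at the right end point. -/
def etaR (ρ x : ℝ) : ℝ := 1 / ρ * mollifier ((x - 1) / ρ)

/-- The node functionals for `0`-forms on the perturbed interval `[yl, yr]`. -/
def node0 (yl yr : ℝ) (u : ℝ → ℝ) : Fin 4 → ℝ :=
  ![deriv u yl, deriv u yr, u yr - u yl, u yr + u yl]

/-- The node functionals for `1`-forms `v dx` on the perturbed interval `[yl, yr]`. -/
def node1 (yl yr : ℝ) (v : ℝ → ℝ) : Fin 3 → ℝ :=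
  ![v yl, v yr, ∫ x in yl..yr, v x]

/-- The average of `N yl yr` over the end points `yl ∈ B_ρ(0)`, `yr ∈ B_ρ(1)`, weighted by
`η_l(yl) η_r(yr)`. -/
def weightedMean (ρ : ℝ) (N : ℝ → ℝ → ℝ) : ℝ :=
  ∫ yl in Metric.ball (0 : ℝ) ρ, ∫ yr in Metric.ball (1 : ℝ) ρ, etaL ρ yl * etaR ρ yr * N yl yr

/-- The weighted node functionals on continuously differentiable `0`-forms. -/
def weightedNode0 (ρ : ℝ) (i : Fin 4) (u : ℝ → ℝ) : ℝ :=
  weightedMean ρ fun yl yr => node0 yl yr u i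

/-- The weighted node functionals on continuous `1`-forms. -/
def weightedNode1 (ρ : ℝ) (i : Fin 3) (v : ℝ → ℝ) : ℝ :=
  weightedMean ρ fun yl yr => node1 yl yr v i

theorem bump_eq (x : ℝ) : bump x = expNegInvGlue (1 - x ^ 2) := by
  unfold bump expNegInvGlue
  rw [sq_abs]
  by_cases h : |x| < 1
  · have h1 : x ^ 2 < 1 := (sq_lt_one_iff_abs_lt_one x).mpr h
    rw [if_pos h, if_neg (by linarith)]
    congr 1
    rw [← neg_sub, one_div, inv_neg]
  · have h1 : ¬ x ^ 2 < 1 := fun h' => h ((sq_lt_one_iff_abs_lt_one x).mp h')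
    rw [if_neg h, if_pos (by linarith)]

theorem contDiff_bump : ContDiff ℝ ∞ bump := by
  rw [funext bump_eq]
  exact expNegInvGlue.contDiff.comp (contDiff_const.sub (contDiff_id.pow 2))

theorem contDiff_mollifier : ContDiff ℝ ∞ mollifier := contDiff_const.mul contDiff_bump

theorem contDiff_etaL (ρ : ℝ) : ContDiff ℝ ∞ (etaL ρ) :=
  contDiff_const.mul (contDiff_mollifier.comp (contDiff_id.div_const ρ))

theorem contDiff_etaR (ρ : ℝ) : ContDiff ℝ ∞ (etaR ρ) :=
  contDiff_const.mul (contDiff_mollifier.comp ((contDiff_id.sub contDiff_const).div_const ρ))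

/-- `η_l` as a continuous function. -/
def cEtaL (ρ : ℝ) : C(ℝ, ℝ) := ⟨etaL ρ, (contDiff_etaL ρ).continuous⟩

/-- `η_r` as a continuous function. -/
def cEtaR (ρ : ℝ) : C(ℝ, ℝ) := ⟨etaR ρ, (contDiff_etaR ρ).continuous⟩

/-- `η_l'` as a continuous function. -/
def cEtaL' (ρ : ℝ) : C(ℝ, ℝ) := ⟨deriv (etaL ρ), (contDiff_etaL ρ).continuous_deriv (by simp)⟩

/-- `η_r'` as a continuous function. -/
def cEtaR' (ρ : ℝ) : C(ℝ, ℝ) := ⟨deriv (etaR ρ), (contDiff_etaR ρ).continuous_deriv (by simp)⟩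

/-- The primitive of `η_l - η_r` vanishing at `-ρ`. -/
def cPrim (ρ : ℝ) : C(ℝ, ℝ) :=
  ⟨fun x => ∫ t in (-ρ)..x, (etaL ρ t - etaR ρ t),
    intervalIntegral.continuous_primitive (fun _ _ =>
      ((contDiff_etaL ρ).continuous.sub (contDiff_etaR ρ).continuous).intervalIntegrable _ _) _⟩

/-- The functional `u ↦ ∫ g u` on `L²(-ρ, 1 + ρ)`. -/
def pairing (ρ : ℝ) (g : C(ℝ, ℝ)) : L2 (-ρ) (1 + ρ) →L[ℝ] ℝ :=
  innerSL ℝ (toL2 (-ρ) (1 + ρ) g)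

/-- The weighted node functionals for `0`-forms, extended continuously to `L²` (after integrating
by parts where they involve `u'`); by `extNode0_eq` they agree with `weightedNode0` on continuously
differentiable functions, which are dense in `L²`. -/
def extNode0 (ρ : ℝ) (i : Fin 4) : L2 (-ρ) (1 + ρ) →L[ℝ] ℝ :=
  pairing ρ (![-cEtaL' ρ, -cEtaR' ρ, cEtaR ρ - cEtaL ρ, cEtaR ρ + cEtaL ρ] i)

/-- The weighted node functionals for `1`-forms, extended continuously to `L²`; by `extNode1_eq`
they agree with `weightedNode1` on continuous functions, which are dense in `L²`. -/
def extNode1 (ρ : ℝ) (i : Fin 3) : L2 (-ρ) (1 + ρ) →L[ℝ] ℝ :=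
  pairing ρ (![cEtaL ρ, cEtaR ρ, cPrim ρ] i)

theorem pairing_apply (ρ : ℝ) (g : C(ℝ, ℝ)) (U : L2 (-ρ) (1 + ρ)) {u : ℝ → ℝ}
    (hU : U =ᵐ[volume.restrict (Ioo (-ρ) (1 + ρ))] u) (hρ : 0 < ρ) :
    pairing ρ g U = ∫ x in (-ρ)..(1 + ρ), g x * u x := by
  rw [intervalIntegral.integral_of_le (by linarith), integral_Ioc_eq_integral_Ioo, pairing,
    innerSL_apply_apply, L2.inner_def]
  refine integral_congr_ae ?_
  filter_upwards [coeFn_toL2 (-ρ) (1 + ρ) g, hU] with x h1 h2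
  rw [h1, h2]
  simp [mul_comm]

theorem bump_nonneg (x : ℝ) : 0 ≤ bump x := by
  rw [bump_eq]
  exact expNegInvGlue.nonneg _

theorem bump_eq_zero {x : ℝ} (h : 1 ≤ |x|) : bump x = 0 := by
  rw [bump, if_neg (not_lt.mpr h)]

theorem integral_mollifier : ∫ x, mollifier x = 1 := by
  unfold mollifier
  rw [integral_const_mul, inv_mul_cancel₀]
  have hs : HasCompactSupport bump := by
    refine HasCompactSupport.of_support_subset_isCompact (isCompact_Icc (a := (-1 : ℝ)) (b := 1)) ?_
    intro x hx
    rw [mem_Icc, ← abs_le]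
    by_contra h
    exact hx (bump_eq_zero (not_le.mp h).le)
  refine ((contDiff_bump.continuous.integral_pos_of_hasCompactSupport_nonneg_nonzero (x := 0) hs
    bump_nonneg ?_)).ne'
  rw [bump_eq, ← (expNegInvGlue.nonneg _).lt_iff_ne'] 
  exact expNegInvGlue.pos_of_pos (by norm_num)

theorem etaL_eq_zero {ρ x : ℝ} (hρ : 0 < ρ) (h : ρ ≤ |x|) : etaL ρ x = 0 := by
  rw [etaL, mollifier, bump_eq_zero, mul_zero, mul_zero]
  rw [abs_div, abs_of_pos hρ, le_div_iff₀ hρ]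
  linarith

theorem etaR_eq (ρ x : ℝ) : etaR ρ x = etaL ρ (x - 1) := rfl

theorem etaR_eq_zero {ρ x : ℝ} (hρ : 0 < ρ) (h : ρ ≤ |x - 1|) : etaR ρ x = 0 :=
  etaL_eq_zero hρ h

theorem integral_etaL {ρ : ℝ} (hρ : 0 < ρ) : ∫ x, etaL ρ x = 1 := by
  unfold etaL
  rw [integral_const_mul, Measure.integral_comp_div, integral_mollifier, abs_of_pos hρ]
  simp [hρ.ne']

theorem integral_etaR {ρ : ℝ} (hρ : 0 < ρ) : ∫ x, etaR ρ x = 1 := by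
  simp only [etaR_eq]
  rw [integral_sub_right_eq_self (fun x => etaL ρ x), integral_etaL hρ]

theorem setIntegral_etaL_mul {ρ : ℝ} (hρ : 0 < ρ) (f : ℝ → ℝ) :
    ∫ x in Metric.ball (0 : ℝ) ρ, etaL ρ x * f x = ∫ x in (-ρ)..(1 + ρ), etaL ρ x * f x := by
  rw [intervalIntegral.integral_of_le (by linarith), setIntegral_eq_integral_of_forall_compl_eq_zero,
    setIntegral_eq_integral_of_forall_compl_eq_zero]
  · intro x hx
    rw [etaL_eq_zero hρ, zero_mul]
    by_contra h
    have := abs_lt.mp (not_le.mp h)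
    exact hx ⟨this.1, by linarith⟩
  · intro x hx
    rw [etaL_eq_zero hρ, zero_mul]
    simpa using hx

theorem setIntegral_etaR_mul {ρ : ℝ} (hρ : 0 < ρ) (f : ℝ → ℝ) :
    ∫ x in Metric.ball (1 : ℝ) ρ, etaR ρ x * f x = ∫ x in (-ρ)..(1 + ρ), etaR ρ x * f x := by
  rw [intervalIntegral.integral_of_le (by linarith), setIntegral_eq_integral_of_forall_compl_eq_zero,
    setIntegral_eq_integral_of_forall_compl_eq_zero]
  · intro x hx
    rw [etaR_eq_zero hρ, zero_mul]
    by_contra h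
    have := abs_lt.mp (not_le.mp h)
    exact hx ⟨by linarith, by linarith⟩
  · intro x hx
    rw [etaR_eq_zero hρ, zero_mul]
    simpa [Real.dist_eq] using hx

theorem intervalIntegral_etaL {ρ : ℝ} (hρ : 0 < ρ) : ∫ x in (-ρ)..(1 + ρ), etaL ρ x = 1 := by
  have h := setIntegral_etaL_mul hρ (fun _ => 1)
  simp only [mul_one] at h
  rw [← h, setIntegral_eq_integral_of_forall_compl_eq_zero, integral_etaL hρ]
  intro x hx
  exact etaL_eq_zero hρ (by simpa using hx)

theorem intervalIntegral_etaR {ρ : ℝ} (hρ : 0 < ρ) : ∫ x in (-ρ)..(1 + ρ), etaR ρ x = 1 := by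
  have h := setIntegral_etaR_mul hρ (fun _ => 1)
  simp only [mul_one] at h
  rw [← h, setIntegral_eq_integral_of_forall_compl_eq_zero, integral_etaR hρ]
  intro x hx
  exact etaR_eq_zero hρ (by simpa [Real.dist_eq] using hx)

/-- For an average of a sum of functions of a single end point, the double integral splits. -/
theorem weightedMean_add {ρ : ℝ} (hρ : 0 < ρ) {N : ℝ → ℝ → ℝ} {f g : ℝ → ℝ}
    (hN : ∀ yl ∈ Metric.ball (0 : ℝ) ρ, ∀ yr ∈ Metric.ball (1 : ℝ) ρ, N yl yr = f yl + g yr)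
    (hf : ContinuousOn f (Icc (-ρ) (1 + ρ))) (hg : ContinuousOn g (Icc (-ρ) (1 + ρ))) :
    weightedMean ρ N
      = (∫ x in (-ρ)..(1 + ρ), etaL ρ x * f x) + ∫ x in (-ρ)..(1 + ρ), etaR ρ x * g x := by
  have hle : -ρ ≤ 1 + ρ := by linarith
  have cL := (contDiff_etaL ρ).continuous
  have cR := (contDiff_etaR ρ).continuous
  have hR : IntervalIntegrable (fun x => etaR ρ x) volume (-ρ) (1 + ρ) := cR.intervalIntegrable _ _
  have hRg : IntervalIntegrable (fun x => etaR ρ x * g x) volume (-ρ) (1 + ρ) :=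
    (cR.continuousOn.mul (by rwa [uIcc_of_le hle])).intervalIntegrable
  have hL : IntervalIntegrable (fun x => etaL ρ x) volume (-ρ) (1 + ρ) := cL.intervalIntegrable _ _
  have hLf : IntervalIntegrable (fun x => etaL ρ x * f x) volume (-ρ) (1 + ρ) :=
    (cL.continuousOn.mul (by rwa [uIcc_of_le hle])).intervalIntegrable
  have inner_eq : ∀ yl ∈ Metric.ball (0 : ℝ) ρ,
      ∫ yr in Metric.ball (1 : ℝ) ρ, etaL ρ yl * etaR ρ yr * N yl yr
        = etaL ρ yl * (f yl + ∫ x in (-ρ)..(1 + ρ), etaR ρ x * g x) := by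
    intro yl hyl
    have e : ∫ yr in Metric.ball (1 : ℝ) ρ, etaL ρ yl * etaR ρ yr * N yl yr
        = ∫ yr in Metric.ball (1 : ℝ) ρ, etaR ρ yr * (etaL ρ yl * (f yl + g yr)) := by
      refine setIntegral_congr_fun Metric.isOpen_ball.measurableSet fun yr hyr => ?_
      simp only [hN yl hyl yr hyr]
      ring
    rw [e, setIntegral_etaR_mul hρ]
    have e2 : ∫ x in (-ρ)..(1 + ρ), etaR ρ x * (etaL ρ yl * (f yl + g x))
        = ∫ x in (-ρ)..(1 + ρ), ((etaL ρ yl * f yl) * etaR ρ x + etaL ρ yl * (etaR ρ x * g x)) :=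
      intervalIntegral.integral_congr fun x _ => by ring
    rw [e2, intervalIntegral.integral_add (hR.const_mul _) (hRg.const_mul _),
      intervalIntegral.integral_const_mul, intervalIntegral.integral_const_mul,
      intervalIntegral_etaR hρ]
    ring
  unfold weightedMean
  rw [setIntegral_congr_fun Metric.isOpen_ball.measurableSet inner_eq, setIntegral_etaL_mul hρ]
  simp only [mul_add]
  rw [intervalIntegral.integral_add hLf (hL.mul_const _), intervalIntegral.integral_mul_const,
    intervalIntegral_etaL hρ, one_mul]

theorem mem_Icc_of_ball0 {ρ y : ℝ} (hy : y ∈ Metric.ball (0 : ℝ) ρ) : y ∈ Ioo (-ρ) (1 + ρ) := by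
  have h := abs_lt.mp (by simpa using hy : |y| < ρ)
  exact ⟨h.1, by linarith⟩

theorem mem_Icc_of_ball1 {ρ y : ℝ} (hy : y ∈ Metric.ball (1 : ℝ) ρ) : y ∈ Ioo (-ρ) (1 + ρ) := by
  have h := abs_lt.mp (by simpa [Real.dist_eq] using hy : |y - 1| < ρ)
  exact ⟨by linarith, by linarith⟩

/-- Integration by parts against a smooth function vanishing at both end points. -/
theorem integral_byParts {ρ : ℝ} (hρ : 0 < ρ) {e u : ℝ → ℝ} (he : ContDiff ℝ ∞ e)
    (h1 : e (-ρ) = 0) (h2 : e (1 + ρ) = 0) (hu : ContDiffOn ℝ 1 u (Icc (-ρ) (1 + ρ))) :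
    ∫ x in (-ρ)..(1 + ρ), e x * derivWithin u (Icc (-ρ) (1 + ρ)) x
      = ∫ x in (-ρ)..(1 + ρ), -deriv e x * u x := by
  have hlt : -ρ < 1 + ρ := by linarith
  have hud := uniqueDiffOn_Icc hlt
  have hc : ContinuousOn (derivWithin u (Icc (-ρ) (1 + ρ))) (Icc (-ρ) (1 + ρ)) :=
    hu.continuousOn_derivWithin hud le_rfl
  rw [intervalIntegral.integral_mul_deriv_eq_deriv_mul_of_hasDerivWithinAt (u' := deriv e)
    (fun x _ => (he.differentiable (by simp) x).hasDerivAt.hasDerivWithinAt)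
    (v := u) (fun x hx => ?_)
    ((he.continuous_deriv (by simp)).intervalIntegrable _ _)
    (by rw [← uIcc_of_le hlt.le] at hc ⊢; exact hc.intervalIntegrable), h1, h2]
  · simp [intervalIntegral.integral_neg]
  · rw [uIcc_of_le hlt.le] at hx ⊢
    exact (hu.differentiableOn one_ne_zero x hx).hasDerivWithinAt

theorem deriv_eq_derivWithin {ρ y : ℝ} (u : ℝ → ℝ) (hy : y ∈ Ioo (-ρ) (1 + ρ)) :
    deriv u y = derivWithin u (Icc (-ρ) (1 + ρ)) y :=
  (derivWithin_of_mem_nhds (Icc_mem_nhds hy.1 hy.2)).symm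

theorem etaL_left {ρ : ℝ} (hρ : 0 < ρ) : etaL ρ (-ρ) = 0 :=
  etaL_eq_zero hρ (by rw [abs_neg, abs_of_pos hρ])

theorem etaL_right {ρ : ℝ} (hρ : 0 < ρ) : etaL ρ (1 + ρ) = 0 :=
  etaL_eq_zero hρ (by rw [abs_of_pos (by linarith)]; linarith)

theorem etaR_left {ρ : ℝ} (hρ : 0 < ρ) : etaR ρ (-ρ) = 0 :=
  etaR_eq_zero hρ (by rw [abs_of_neg (by linarith)]; linarith)

theorem etaR_right {ρ : ℝ} (hρ : 0 < ρ) : etaR ρ (1 + ρ) = 0 :=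
  etaR_eq_zero hρ (by rw [abs_of_pos (by linarith)]; linarith)

/-- The functionals `extNode0` extend the weighted node functionals of `C¹` functions. -/
theorem extNode0_eq {ρ : ℝ} (hρ : 0 < ρ) {u : ℝ → ℝ}
    (hu : ContDiffOn ℝ 1 u (Icc (-ρ) (1 + ρ))) (U : L2 (-ρ) (1 + ρ))
    (hU : U =ᵐ[volume.restrict (Ioo (-ρ) (1 + ρ))] u) (i : Fin 4) :
    extNode0 ρ i U = weightedNode0 ρ i u := by
  have hlt : -ρ < 1 + ρ := by linarith
  have hc : ContinuousOn (derivWithin u (Icc (-ρ) (1 + ρ))) (Icc (-ρ) (1 + ρ)) :=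
    hu.continuousOn_derivWithin (uniqueDiffOn_Icc hlt) le_rfl
  have hz : ContinuousOn (fun _ : ℝ => (0 : ℝ)) (Icc (-ρ) (1 + ρ)) := continuousOn_const
  have hL : IntervalIntegrable (fun x => etaL ρ x * u x) volume (-ρ) (1 + ρ) :=
    ((contDiff_etaL ρ).continuous.continuousOn.mul
      (by rw [uIcc_of_le hlt.le]; exact hu.continuousOn)).intervalIntegrable
  have hR : IntervalIntegrable (fun x => etaR ρ x * u x) volume (-ρ) (1 + ρ) :=
    ((contDiff_etaR ρ).continuous.continuousOn.mul
      (by rw [uIcc_of_le hlt.le]; exact hu.continuousOn)).intervalIntegrable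
  rw [extNode0, pairing_apply ρ _ U hU hρ, weightedNode0]
  fin_cases i
  · rw [weightedMean_add hρ (f := derivWithin u (Icc (-ρ) (1 + ρ))) (g := fun _ => 0) ?_ hc hz,
      integral_byParts hρ (contDiff_etaL ρ) (etaL_left hρ) (etaL_right hρ) hu]
    · simp [cEtaL']
    · intro yl hyl yr _
      simp [node0, deriv_eq_derivWithin u (mem_Icc_of_ball0 hyl)]
  · rw [weightedMean_add hρ (f := fun _ => 0) (g := derivWithin u (Icc (-ρ) (1 + ρ))) ?_ hz hc,
      integral_byParts hρ (contDiff_etaR ρ) (etaR_left hρ) (etaR_right hρ) hu]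
    · simp [cEtaR']
    · intro yl _ yr hyr
      simp [node0, deriv_eq_derivWithin u (mem_Icc_of_ball1 hyr)]
  · rw [weightedMean_add hρ (f := fun x => -u x) (g := u) ?_ hu.continuousOn.neg hu.continuousOn]
    · simp only [mul_neg, intervalIntegral.integral_neg]
      rw [neg_add_eq_sub, ← intervalIntegral.integral_sub hR hL]
      exact intervalIntegral.integral_congr fun x _ => by simp [cEtaL, cEtaR, sub_mul]
    · intro yl _ yr _
      simp [node0]
      ring
  · rw [weightedMean_add hρ (f := u) (g := u) ?_ hu.continuousOn hu.continuousOn]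
    · rw [← intervalIntegral.integral_add hL hR]
      exact intervalIntegral.integral_congr fun x _ => by simp [cEtaL, cEtaR, add_mul, add_comm]
    · intro yl _ yr _
      simp [node0]
      ring

/-- The functionals `extNode1` extend the weighted node functionals of continuous functions. -/
theorem extNode1_eq {ρ : ℝ} (hρ : 0 < ρ) {v : ℝ → ℝ}
    (hv : ContinuousOn v (Icc (-ρ) (1 + ρ))) (V : L2 (-ρ) (1 + ρ))
    (hV : V =ᵐ[volume.restrict (Ioo (-ρ) (1 + ρ))] v) (i : Fin 3) :
    extNode1 ρ i V = weightedNode1 ρ i v := by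
  have hlt : -ρ < 1 + ρ := by linarith
  have hz : ContinuousOn (fun _ : ℝ => (0 : ℝ)) (Icc (-ρ) (1 + ρ)) := continuousOn_const
  rw [extNode1, pairing_apply ρ _ V hV hρ, weightedNode1]
  fin_cases i
  · rw [weightedMean_add hρ (f := v) (g := fun _ => 0) ?_ hv hz]
    · simp [cEtaL]
    · intro yl _ yr _
      simp [node1]
  · rw [weightedMean_add hρ (f := fun _ => 0) (g := v) ?_ hz hv]
    · simp [cEtaR]
    · intro yl _ yr _
      simp [node1]
  · have hii : ∀ x ∈ Icc (-ρ) (1 + ρ), ∀ y ∈ Icc (-ρ) (1 + ρ), IntervalIntegrable v volume x y :=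
      fun x hx y hy => (hv.mono (uIcc_subset_Icc hx hy)).intervalIntegrable
    have hl : -ρ ∈ Icc (-ρ) (1 + ρ) := left_mem_Icc.mpr hlt.le
    have hVc : ContinuousOn (fun x => ∫ t in (-ρ)..x, v t) (Icc (-ρ) (1 + ρ)) := by
      have := intervalIntegral.continuousOn_primitive_interval' (hii _ hl _
        (right_mem_Icc.mpr hlt.le)) left_mem_uIcc
      rwa [uIcc_of_le hlt.le] at this
    have hcont : Continuous fun t => etaL ρ t - etaR ρ t :=
      (contDiff_etaL ρ).continuous.sub (contDiff_etaR ρ).continuous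
    rw [weightedMean_add hρ (f := fun x => -∫ t in (-ρ)..x, v t)
      (g := fun x => ∫ t in (-ρ)..x, v t) ?_ hVc.neg hVc]
    · have hVu : ContinuousOn (fun x => ∫ t in (-ρ)..x, v t) (uIcc (-ρ) (1 + ρ)) := by
        rwa [uIcc_of_le hlt.le]
      have hLV : IntervalIntegrable (fun x => etaL ρ x * ∫ t in (-ρ)..x, v t) volume
          (-ρ) (1 + ρ) :=
        ((contDiff_etaL ρ).continuous.continuousOn.mul hVu).intervalIntegrable
      have hRV : IntervalIntegrable (fun x => etaR ρ x * ∫ t in (-ρ)..x, v t) volume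
          (-ρ) (1 + ρ) :=
        ((contDiff_etaR ρ).continuous.continuousOn.mul hVu).intervalIntegrable
      have hparts := intervalIntegral.integral_mul_deriv_eq_deriv_mul_of_hasDerivAt
        (a := -ρ) (b := 1 + ρ)
        (u := fun x => ∫ t in (-ρ)..x, (etaL ρ t - etaR ρ t)) (u' := fun t => etaL ρ t - etaR ρ t)
        (v := fun x => ∫ t in (-ρ)..x, v t) (v' := v)
        (cPrim ρ).continuous.continuousOn hVu
        (fun x _ => hcont.integral_hasStrictDerivAt _ x |>.hasDerivAt)
        (fun x hx => by
          rw [min_eq_left hlt.le, max_eq_right hlt.le] at hx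
          have hn : Icc (-ρ) (1 + ρ) ∈ nhds x := Icc_mem_nhds hx.1 hx.2
          exact intervalIntegral.integral_hasDerivAt_right (hii _ hl _ (Ioo_subset_Icc_self hx))
            (ContinuousOn.stronglyMeasurableAtFilter isOpen_Ioo (hv.mono Ioo_subset_Icc_self) x hx)
            (hv.continuousAt hn))
        (hcont.intervalIntegrable _ _) (hii _ hl _ (right_mem_Icc.mpr hlt.le))
      have hzero : ∫ t in (-ρ)..(1 + ρ), (etaL ρ t - etaR ρ t) = 0 := by
        rw [intervalIntegral.integral_sub ((contDiff_etaL ρ).continuous.intervalIntegrable _ _)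
          ((contDiff_etaR ρ).continuous.intervalIntegrable _ _), intervalIntegral_etaL hρ,
          intervalIntegral_etaR hρ, sub_self]
      change ∫ x in (-ρ)..(1 + ρ), (∫ t in (-ρ)..x, (etaL ρ t - etaR ρ t)) * v x = _
      rw [hparts, hzero]
      simp only [mul_neg, intervalIntegral.integral_neg, intervalIntegral.integral_same, sub_mul]
      rw [intervalIntegral.integral_sub hLV hRV]
      ring
    · intro yl hyl yr hyr
      have h1 := Ioo_subset_Icc_self (mem_Icc_of_ball0 hyl)
      have h2 := Ioo_subset_Icc_self (mem_Icc_of_ball1 hyr)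
      have := intervalIntegral.integral_interval_sub_left (hii _ hl _ h2) (hii _ hl _ h1)
      simp only [node1]
      change ∫ x in yl..yr, v x = _
      rw [← this]
      ring

end Nodes

/-! ### Tensor products of two-term complexes -/

section TensorComplex

/-- The set `χ_k` of binary vectors of length `n` with exactly `k` entries equal to `1`. -/
abbrev Chi (n k : ℕ) : Type := {i : Fin n → Fin 2 // ∑ j, (i j : ℕ) = k}

variable (E : Fin 2 → Type) [∀ a, NormedAddCommGroup (E a)] [∀ a, InnerProductSpace ℝ (E a)]
  (F : Fin 2 → Type) [∀ a, NormedAddCommGroup (F a)] [∀ a, InnerProductSpace ℝ (F a)]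

/-- The space `⨁_{i ∈ χ_k} E^{i₁} ⊗ ⋯ ⊗ E^{iₙ}` of degree `k` in the `n`-fold tensor power of a
two-term complex `E⁰ → E¹`. -/
abbrev TensorForm (n k : ℕ) : Type := ∀ i : Chi n k, HilbertTensor fun j => E (i.1 j)

/-- The identity `E^a → E^b` if `a = b`, and zero otherwise. -/
def idBlock : ∀ a b : Fin 2, E a →L[ℝ] E b
  | 0, 0 => ContinuousLinearMap.id ℝ (E 0)
  | 1, 1 => ContinuousLinearMap.id ℝ (E 1)
  | 0, 1 => 0
  | 1, 0 => 0

/-- The differential `d : E^a → E^b` if `b = a + 1`, and zero otherwise. -/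
def dBlock (d : E 0 →L[ℝ] E 1) : ∀ a b : Fin 2, E a →L[ℝ] E b
  | 0, 1 => d
  | 0, 0 => 0
  | 1, 0 => 0
  | 1, 1 => 0

/-- The sign `θ_j = (-1)^(i₁ + ⋯ + i_{j-1})`. -/
def sign {n : ℕ} (i : Fin n → Fin 2) (j : Fin n) : ℝ := (-1) ^ ∑ l ∈ Finset.Iio j, (i l : ℕ)

/-- The component from the summand `i` to the summand `i'` of the operator
`u₁ ⊗ ⋯ ⊗ uₙ ↦ u₁ ⊗ ⋯ ⊗ d u_j ⊗ ⋯ ⊗ uₙ`; it is zero unless `i'` arises from `i` by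
increasing the entry `j`. -/
def dFactor (d : E 0 →L[ℝ] E 1) {n : ℕ} (j : Fin n) (i i' : Fin n → Fin 2) :
    (HilbertTensor fun l => E (i l)) →L[ℝ] HilbertTensor fun l => E (i' l) :=
  HilbertTensor.map fun l => if l = j then dBlock E d (i l) (i' l) else idBlock E (i l) (i' l)

/-- The differential of the `n`-fold tensor power of `d : E⁰ → E¹`, given on rank-one elements by
`d(u₁ ⊗ ⋯ ⊗ uₙ) = ∑_j θ_j u₁ ⊗ ⋯ ⊗ d u_j ⊗ ⋯ ⊗ uₙ`. -/
def tensorD (d : E 0 →L[ℝ] E 1) (n k : ℕ) : TensorForm E n k →L[ℝ] TensorForm E n (k + 1) :=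
  ContinuousLinearMap.pi fun i' => ∑ i : Chi n k, ∑ j : Fin n,
    (sign i.1 j • dFactor E d j i.1 i'.1).comp (ContinuousLinearMap.proj i)

variable {E F} in
/-- The operator `∑_{i' ∈ χ_k} T_{i'₁} ⊗ ⋯ ⊗ T_{i'ₙ}` on degree-`k` tensors, where
`T_b : E⁰ ⊕ E¹ → F^b` is given by its restrictions `T a b : E^a → F^b`. -/
def tensorOp (T : ∀ a b : Fin 2, E a →L[ℝ] F b) (n k : ℕ) :
    TensorForm E n k →L[ℝ] TensorForm F n k :=
  ContinuousLinearMap.pi fun i' => ∑ i : Chi n k,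
    (HilbertTensor.map fun l => T (i.1 l) (i'.1 l)).comp (ContinuousLinearMap.proj i)

end TensorComplex

/-! ### The quasi-interpolation operators -/

section QuasiInterpolation

/-- The spaces `HΛ⁰(I_ρ)` and `HΛ¹(I_ρ)`, with `I_ρ = (-ρ, 1 + ρ)`. -/
def HLam (ρ : ℝ) (k : Fin 2) : Type := HForm (-ρ) (1 + ρ) k

instance (ρ : ℝ) (k : Fin 2) : NormedAddCommGroup (HLam ρ k) :=
  inferInstanceAs (NormedAddCommGroup (HForm (-ρ) (1 + ρ) k))

instance (ρ : ℝ) (k : Fin 2) : InnerProductSpace ℝ (HLam ρ k) :=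
  inferInstanceAs (InnerProductSpace ℝ (HForm (-ρ) (1 + ρ) k))

/-- The spaces `L²Λ⁰(I_ρ)` and `L²Λ¹(I_ρ)`; a `1`-form `v dx` is identified with `v`. -/
def L2Lam (ρ : ℝ) (_k : Fin 2) : Type := L2 (-ρ) (1 + ρ)

instance (ρ : ℝ) (k : Fin 2) : NormedAddCommGroup (L2Lam ρ k) :=
  inferInstanceAs (NormedAddCommGroup (L2 (-ρ) (1 + ρ)))

instance (ρ : ℝ) (k : Fin 2) : InnerProductSpace ℝ (L2Lam ρ k) :=
  inferInstanceAs (InnerProductSpace ℝ (L2 (-ρ) (1 + ρ)))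

/-- The spaces `P₃Λ⁰(I)` and `P₂Λ¹(I)`. -/
def PLam (k : Fin 2) : Type := PForm k

instance (k : Fin 2) : NormedAddCommGroup (PLam k) :=
  inferInstanceAs (NormedAddCommGroup (PForm k))

instance (k : Fin 2) : InnerProductSpace ℝ (PLam k) :=
  inferInstanceAs (InnerProductSpace ℝ (PForm k))

/-- The one-dimensional quasi-interpolation operator `Π₀`. -/
def quasiInterp0 (ρ : ℝ) : L2Lam ρ 0 →L[ℝ] PLam 0 :=
  ∑ i, (extNode0 ρ i).smulRight (⟨polyForm 0 1 0 (phi0 i), phi0_mem i⟩ : PLam 0)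

/-- The one-dimensional quasi-interpolation operator `Π₁`. -/
def quasiInterp1 (ρ : ℝ) : L2Lam ρ 1 →L[ℝ] PLam 1 :=
  ∑ i, (extNode1 ρ i).smulRight (⟨polyForm 0 1 1 (phi1 i), phi1_mem i⟩ : PLam 1)

/-- The restriction to `a`-forms of `Π_b`, where `Π₀` is extended by zero to `1`-forms and `Π₁` is
extended by zero to `0`-forms. -/
def quasiInterp (ρ : ℝ) : ∀ a b : Fin 2, L2Lam ρ a →L[ℝ] PLam b
  | 0, 0 => quasiInterp0 ρ
  | 1, 1 => quasiInterp1 ρ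
  | 0, 1 => 0
  | 1, 0 => 0

/-- The inclusion `HΛᵏ(I_ρ) ⊆ L²Λᵏ(I_ρ)`. -/
def HLam.incl (ρ : ℝ) (k : Fin 2) : HLam ρ k →L[ℝ] L2Lam ρ k := HForm.incl (-ρ) (1 + ρ) k

/-- The exterior derivative `d : HΛ⁰(I_ρ) → HΛ¹(I_ρ)`. -/
def HLam.d (ρ : ℝ) : HLam ρ 0 →L[ℝ] HLam ρ 1 := HForm.d (-ρ) (1 + ρ)

/-- The exterior derivative `d : P₃Λ⁰(I) → P₂Λ¹(I)`. -/
def PLam.d : PLam 0 →L[ℝ] PLam 1 := PForm.d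

/-- The space `(HΛ^{⊗n})^k` on the cube `I_ρⁿ`. -/
abbrev HTensor (ρ : ℝ) (n k : ℕ) : Type := TensorForm (HLam ρ) n k

/-- The space `(L²Λ^{⊗n})^k` on the cube `I_ρⁿ`. -/
abbrev L2Tensor (ρ : ℝ) (n k : ℕ) : Type := TensorForm (L2Lam ρ) n k

/-- The finite element space `(PΛ^{⊗n})^k` on the cube `Iⁿ`. -/
abbrev PTensor (n k : ℕ) : Type := TensorForm PLam n k

/-- The exterior derivative on `(HΛ^{⊗n})^k`. -/
def dH (ρ : ℝ) (n k : ℕ) : HTensor ρ n k →L[ℝ] HTensor ρ n (k + 1) :=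
  tensorD (HLam ρ) (HLam.d ρ) n k

/-- The exterior derivative on `(PΛ^{⊗n})^k`. -/
def dP (n k : ℕ) : PTensor n k →L[ℝ] PTensor n (k + 1) :=
  tensorD PLam PLam.d n k

/-- The inclusion `(HΛ^{⊗n})^k ⊆ (L²Λ^{⊗n})^k`. -/
def inclL2 (ρ : ℝ) (n k : ℕ) : HTensor ρ n k →L[ℝ] L2Tensor ρ n k :=
  ContinuousLinearMap.pi fun i =>
    (HilbertTensor.map fun j => HLam.incl ρ (i.1 j)).comp (ContinuousLinearMap.proj i)

/-- The tensor product quasi-interpolation operator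
`Π^k = ∑_{i ∈ χ_k} Π_{i₁} ⊗ ⋯ ⊗ Π_{iₙ} : (L²Λ^{⊗n})^k → (PΛ^{⊗n})^k`. -/
def tensorQuasiInterp (ρ : ℝ) (n k : ℕ) : L2Tensor ρ n k →L[ℝ] PTensor n k :=
  tensorOp (quasiInterp ρ) n k

end QuasiInterpolation

end QuasiInterp

end

namespace QuasiInterp

/-! ### Operators on tensor powers of two-term complexes -/

section TensorOperators

variable {n : ℕ} {E F : Fin n → Type}
  [∀ j, NormedAddCommGroup (E j)] [∀ j, InnerProductSpace ℝ (E j)]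
  [∀ j, NormedAddCommGroup (F j)] [∀ j, InnerProductSpace ℝ (F j)]

/-! The statement reduces to the one-dimensional identity `Π₁ d = d Π₀` and the fact that tensor
powers of a map of two-term complexes commute with the tensor differential.

In one dimension, the extended functionals are pairings with smooth kernels. In degree one the
kernels are `η_l`, `η_r` and the primitive of `η_l - η_r`; the first three kernels in degree zero
are minus the derivatives of these. Moving the derivative across the pairing gives
`extNode1_weakDeriv`. Since the first three basis polynomials of degree zero differentiate to those
of degree one and the fourth is constant, `sum_extNode_comm_d` follows. One analytic point remains:
the kernels are supported in the closed interval `[-ρ, 1 + ρ]` but not compactly in its interior, so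
they are not admissible test functions. `HasWeakDeriv.integral_eq_of_support_subset_Icc` removes
this obstacle by contracting them towards the midpoint.

In `n` dimensions, `Π^k` preserves each multi-index, so on a summand it is the tensor product of the
one-dimensional operators (`tensorQuasiInterp_inclL2_apply`). By density, commutation with each
component of the differential need only be tested on rank-one tensors, where it holds factor by
factor (`map_dFactor`). The signs depend only on the source multi-index and are the same on both
sides. -/

theorem HilbertTensor.pure_eq_zero {u : ∀ j, E j} {j : Fin n} (h : u j = 0) :
    HilbertTensor.pure u = 0 := by
  rw [← inner_self_eq_zero (𝕜 := ℝ), HilbertTensor.inner_pure]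
  exact Finset.prod_eq_zero (Finset.mem_univ j) (by rw [h, inner_zero_left])

theorem HilbertTensor.map_eq_zero {T : ∀ j, E j →L[ℝ] F j} {j : Fin n} (h : T j = 0) :
    HilbertTensor.map T = 0 := by
  refine HilbertTensor.ext fun u => ?_
  rw [HilbertTensor.map_pure]
  exact HilbertTensor.pure_eq_zero (j := j) (by rw [h]; rfl)

end TensorOperators

/-! ### Summandwise operators and the components of the tensor differential. -/

section Diagonal

variable {E F : Fin 2 → Type} [∀ a, NormedAddCommGroup (E a)] [∀ a, InnerProductSpace ℝ (E a)]
  [∀ a, NormedAddCommGroup (F a)] [∀ a, InnerProductSpace ℝ (F a)]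

/-- A degree-preserving operator acts summandwise on the tensor power. -/
theorem tensorOp_apply_of_diagonal {T : ∀ a b : Fin 2, E a →L[ℝ] F b}
    (hT : ∀ a b, a ≠ b → T a b = 0) {n k : ℕ} (u : TensorForm E n k) (i : Chi n k) :
    tensorOp T n k u i = HilbertTensor.map (fun l => T (i.1 l) (i.1 l)) (u i) := by
  simp only [tensorOp, ContinuousLinearMap.pi_apply, sum_apply,
    ContinuousLinearMap.comp_apply, ContinuousLinearMap.proj_apply]
  -- A source multi-index other than `i` differs from it in some slot; the factor there is an
  -- off-diagonal block, and a single zero factor annihilates the tensor product.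
  refine Finset.sum_eq_single i (fun m _ hm => ?_) (fun h => absurd (Finset.mem_univ i) h)
  obtain ⟨l, hl⟩ : ∃ l, m.1 l ≠ i.1 l := by
    by_contra! h
    exact hm (Subtype.ext (funext h))
  rw [HilbertTensor.map_eq_zero (j := l) (hT _ _ hl), zero_apply]

/-- Tensor powers of a map of two-term complexes intertwine the components of the
differentials. -/
theorem map_dFactor {dE : E 0 →L[ℝ] E 1} {dF : F 0 →L[ℝ] F 1} (S : ∀ a, E a →L[ℝ] F a)
    (hS : ∀ u, S 1 (dE u) = dF (S 0 u)) {n : ℕ} (j : Fin n) (i i' : Fin n → Fin 2)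
    (u : HilbertTensor fun l => E (i l)) :
    HilbertTensor.map (fun l => S (i' l)) (dFactor E dE j i i' u)
      = dFactor F dF j i i' (HilbertTensor.map (fun l => S (i l)) u) := by
  -- Among the four blocks only `(0, 1)` is nonzero, and there the claim is `hS`. Treating all
  -- blocks alike avoids asking whether `i'` arises from `i` by raising the entry `j`.
  have hd : ∀ (a b : Fin 2) (x : E a), S b (dBlock E dE a b x) = dBlock F dF a b (S a x) := by
    intro a b x
    fin_cases a <;> fin_cases b <;> simp [dBlock, hS]
  have hi : ∀ (a b : Fin 2) (x : E a), S b (idBlock E a b x) = idBlock F a b (S a x) := by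
    intro a b x
    fin_cases a <;> fin_cases b <;> simp [idBlock]
  -- An equality of bounded operators, unlike one at a fixed `u`, can be checked on rank-one
  -- tensors.
  suffices h : (HilbertTensor.map fun l => S (i' l)).comp (dFactor E dE j i i')
      = (dFactor F dF j i i').comp (HilbertTensor.map fun l => S (i l)) from
    DFunLike.congr_fun h u
  refine HilbertTensor.ext fun x => ?_
  simp only [ContinuousLinearMap.comp_apply, dFactor, HilbertTensor.map_pure]
  congr 1
  funext l
  by_cases hl : l = j
  · simp only [if_pos hl, hd]
  · simp only [if_neg hl, hi]

theorem tensorD_apply (d : E 0 →L[ℝ] E 1) {n k : ℕ} (u : TensorForm E n k)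
    (i' : Chi n (k + 1)) :
    tensorD E d n k u i'
      = ∑ i : Chi n k, ∑ j : Fin n, sign i.1 j • dFactor E d j i.1 i'.1 (u i) := by
  simp [tensorD]

end Diagonal

/-! ### Integration by parts for weak derivatives -/

section WeakDerivative

/-- A weak derivative may be tested against smooth functions supported in the closed interval. -/
theorem HasWeakDeriv.integral_eq_of_support_subset_Icc {a b : ℝ} {u w : L2 a b}
    (h : HasWeakDeriv a b u w) {φ : ℝ → ℝ} (hφ : ContDiff ℝ ∞ φ)
    (hs : Function.support φ ⊆ Icc a b) :
    ∫ x in Ioo a b, u x * deriv φ x = -∫ x in Ioo a b, w x * φ x := by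
  rcases le_or_gt b a with hab | hab
  · simp [Ioo_eq_empty (not_lt.mpr hab)]
  -- Dilation about the midpoint by a factor `s > 1` turns `φ` into `x ↦ φ (m + s (x - m))`, which
  -- is compactly supported in the open interval. The identity for `φ` is the limit as `s` decreases
  -- to `1`.
  set m : ℝ := (a + b) / 2 with hm
  have hφs : HasCompactSupport φ := HasCompactSupport.of_support_subset_isCompact isCompact_Icc hs
  have hφ' : Continuous (deriv φ) := hφ.continuous_deriv (by simp)
  obtain ⟨C, hC⟩ := hφ.continuous.bounded_above_of_compact_support hφs
  obtain ⟨C', hC'⟩ := hφ'.bounded_above_of_compact_support hφs.deriv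
  have hint : ∀ v : L2 a b, Integrable v (volume.restrict (Ioo a b)) := fun v =>
    (Lp.memLp v).integrable (by norm_num)
  set A : ℝ → ℝ := fun s => ∫ x in Ioo a b, u x * (s * deriv φ (m + s * (x - m))) with hA
  set B : ℝ → ℝ := fun s => ∫ x in Ioo a b, w x * φ (m + s * (x - m)) with hB
  have hAc : ContinuousAt A 1 := by
    -- The factor `2` bounds `s`, which is kept in `(0, 2)` near `1`.
    refine continuousAt_of_dominated (bound := fun x => ‖u x‖ * (2 * C')) ?_ ?_
      ((hint u).norm.mul_const _) ?_
    · refine Filter.Eventually.of_forall fun s => (hint u).aestronglyMeasurable.mul ?_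
      exact Continuous.aestronglyMeasurable (by fun_prop)
    · filter_upwards [Ioo_mem_nhds (show (0 : ℝ) < 1 by norm_num) (show (1 : ℝ) < 2 by norm_num)]
        with s hs'
      refine Filter.Eventually.of_forall fun x => ?_
      rw [norm_mul, norm_mul]
      gcongr
      · rw [Real.norm_of_nonneg hs'.1.le]
        exact hs'.2.le
      · exact hC' _
    · exact Filter.Eventually.of_forall fun x => Continuous.continuousAt (by fun_prop)
  have hBc : ContinuousAt B 1 := by
    have := hφ.continuous
    refine continuousAt_of_dominated (bound := fun x => ‖w x‖ * C) ?_ ?_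
      ((hint w).norm.mul_const _) ?_
    · refine Filter.Eventually.of_forall fun s => (hint w).aestronglyMeasurable.mul ?_
      exact Continuous.aestronglyMeasurable (by fun_prop)
    · refine Filter.Eventually.of_forall fun s => Filter.Eventually.of_forall fun x => ?_
      rw [norm_mul]
      gcongr
      exact hC _
    · exact Filter.Eventually.of_forall fun x => Continuous.continuousAt (by fun_prop)
  have hAB : ∀ s ∈ Ioi (1 : ℝ), A s = -B s := by
    intro s hs1
    have hs0 : (0 : ℝ) < s := zero_lt_one.trans hs1
    -- The half-length of the interval containing the support shrinks by the factor `s`, which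
    -- leaves a positive margin at both ends.
    have hlt : (b - a) / (2 * s) < (b - a) / 2 := by
      apply div_lt_div_of_pos_left (by linarith) (by norm_num)
      linarith [mem_Ioi.mp hs1]
    have hsub : Function.support (fun x => φ (m + s * (x - m)))
        ⊆ Icc (m - (b - a) / (2 * s)) (m + (b - a) / (2 * s)) := by
      intro x hx
      have hx' := hs (show m + s * (x - m) ∈ Function.support φ from hx)
      have e : (b - a) / (2 * s) = (b - a) / 2 / s := by rw [div_div]
      have h1 : x - m ≤ (b - a) / (2 * s) := by
        rw [e, le_div_iff₀ hs0]
        linarith [hx'.2]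
      have h2 : -(x - m) ≤ (b - a) / (2 * s) := by
        rw [e, le_div_iff₀ hs0]
        linarith [hx'.1]
      constructor <;> linarith
    have key := h (fun x => φ (m + s * (x - m))) (hφ.comp (by fun_prop))
      (HasCompactSupport.of_support_subset_isCompact isCompact_Icc hsub)
      -- The topological support lies in the smaller closed interval, hence in the open interval
      -- `(a, b)`.
      ((closure_minimal hsub isClosed_Icc).trans fun x hx =>
        ⟨by linarith [hx.1], by linarith [hx.2]⟩)
    have hd : ∀ x, deriv (fun x => φ (m + s * (x - m))) x = s * deriv φ (m + s * (x - m)) := by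
      intro x
      have h1 : HasDerivAt (fun x : ℝ => m + s * (x - m)) s x := by
        simpa using (((hasDerivAt_id x).sub_const m).const_mul s).const_add m
      have h2 := ((hφ.differentiable (by simp) (m + s * (x - m))).hasDerivAt).comp x h1
      rw [mul_comm]
      exact h2.deriv
    simpa only [hd] using key
  have hlim : A 1 = -B 1 := by
    -- The identity is known only for `s > 1`, so the two continuous functions are compared through
    -- their right-hand limits at `1`.
    refine tendsto_nhds_unique (l := nhdsWithin 1 (Ioi (1 : ℝ)))
      (hAc.tendsto.mono_left nhdsWithin_le_nhds) ?_
    refine (hBc.neg.tendsto.mono_left nhdsWithin_le_nhds).congr' ?_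
    filter_upwards [self_mem_nhdsWithin] with s hs'
    exact (hAB s hs').symm
  simpa [hA, hB] using hlim

/-- The domain and the order of the factors match those in `HasWeakDeriv`, and no representative of
`u` has to be chosen. -/
theorem pairing_eq_setIntegral (ρ : ℝ) (g : C(ℝ, ℝ)) (u : L2 (-ρ) (1 + ρ)) :
    pairing ρ g u = ∫ x in Ioo (-ρ) (1 + ρ), u x * g x := by
  rw [pairing, innerSL_apply_apply, L2.inner_def]
  refine integral_congr_ae ?_
  filter_upwards [coeFn_toL2 (-ρ) (1 + ρ) g] with x hx
  rw [hx]
  simp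

/-- The minus sign in the kernel `g'` cancels the one in the definition of the weak derivative.
Keeping `g'` as a separate function with a pointwise hypothesis lets it be any of the bundled
kernels of `extNode0`. -/
theorem pairing_neg_deriv {ρ : ℝ} {u w : L2 (-ρ) (1 + ρ)} (h : HasWeakDeriv (-ρ) (1 + ρ) u w)
    {g g' : C(ℝ, ℝ)} (hg : ContDiff ℝ ∞ g) (hs : Function.support g ⊆ Icc (-ρ) (1 + ρ))
    (hg' : ∀ x, g' x = -deriv g x) : pairing ρ g' u = pairing ρ g w := by
  rw [pairing_eq_setIntegral, pairing_eq_setIntegral]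
  simp only [hg', mul_neg, integral_neg]
  rw [h.integral_eq_of_support_subset_Icc hg hs, neg_neg]

end WeakDerivative

/-! ### The one-dimensional quasi-interpolation operators commute with `d` -/

section OneDimCommute

/-- The closed interval is essential for later use: the closure of the support contains the end
point `-ρ`. -/
theorem support_etaL {ρ : ℝ} (hρ : 0 < ρ) : Function.support (etaL ρ) ⊆ Icc (-ρ) (1 + ρ) := by
  intro x hx
  have h := abs_lt.mp (not_le.mp fun h => hx (etaL_eq_zero hρ h))
  exact ⟨h.1.le, by linarith⟩

theorem support_etaR {ρ : ℝ} (hρ : 0 < ρ) : Function.support (etaR ρ) ⊆ Icc (-ρ) (1 + ρ) := by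
  intro x hx
  have h := abs_lt.mp (not_le.mp fun h => hx (etaR_eq_zero hρ h))
  exact ⟨by linarith, by linarith⟩

theorem hasDerivAt_cPrim (ρ x : ℝ) : HasDerivAt (cPrim ρ) (etaL ρ x - etaR ρ x) x :=
  ((((contDiff_etaL ρ).continuous.sub (contDiff_etaR ρ).continuous).integral_hasStrictDerivAt
    _ x)).hasDerivAt

theorem contDiff_cPrim (ρ : ℝ) : ContDiff ℝ ∞ (cPrim ρ) := by
  rw [contDiff_infty_iff_deriv]
  refine ⟨fun x => (hasDerivAt_cPrim ρ x).differentiableAt, ?_⟩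
  rw [show deriv (cPrim ρ) = fun x => etaL ρ x - etaR ρ x from
    funext fun x => (hasDerivAt_cPrim ρ x).deriv]
  exact (contDiff_etaL ρ).sub (contDiff_etaR ρ)

/-- To the left of `-ρ` the integrand vanishes; to the right of `1 + ρ` the primitive has reached
the total integral of `η_l - η_r`, which is zero because both mollifiers have mass one. -/
theorem support_cPrim {ρ : ℝ} (hρ : 0 < ρ) : Function.support (cPrim ρ) ⊆ Icc (-ρ) (1 + ρ) := by
  have hii : ∀ x y, IntervalIntegrable (fun t => etaL ρ t - etaR ρ t) volume x y := fun x y =>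
    ((contDiff_etaL ρ).continuous.sub (contDiff_etaR ρ).continuous).intervalIntegrable x y
  -- Vanishing at the end points themselves is included, because the congruences of integrals below
  -- run over closed intervals that contain them.
  have hout : ∀ t, t ∉ Ioo (-ρ) (1 + ρ) → etaL ρ t - etaR ρ t = 0 := by
    intro t ht
    rw [etaL_eq_zero hρ, etaR_eq_zero hρ, sub_zero]
    · by_contra h
      have := abs_lt.mp (not_le.mp h)
      exact ht ⟨by linarith, by linarith⟩
    · by_contra h
      have := abs_lt.mp (not_le.mp h)
      exact ht ⟨by linarith, by linarith⟩
  have hfull : ∫ t in (-ρ)..(1 + ρ), (etaL ρ t - etaR ρ t) = 0 := by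
    rw [intervalIntegral.integral_sub ((contDiff_etaL ρ).continuous.intervalIntegrable _ _)
      ((contDiff_etaR ρ).continuous.intervalIntegrable _ _), intervalIntegral_etaL hρ,
      intervalIntegral_etaR hρ, sub_self]
  intro x hx
  by_contra hmem
  apply hx
  change ∫ t in (-ρ)..x, (etaL ρ t - etaR ρ t) = 0
  rw [mem_Icc, not_and_or, not_le, not_le] at hmem
  rcases hmem with hlt | hlt
  · refine (intervalIntegral.integral_congr (g := fun _ => (0 : ℝ)) fun t ht => ?_).trans (by simp)
    rw [uIcc_of_ge hlt.le] at ht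
    exact hout t fun h => absurd h.1 (not_lt.mpr ht.2)
  · rw [← intervalIntegral.integral_add_adjacent_intervals (hii (-ρ) (1 + ρ)) (hii (1 + ρ) x),
      hfull, zero_add]
    refine (intervalIntegral.integral_congr (g := fun _ => (0 : ℝ)) fun t ht => ?_).trans (by simp)
    rw [uIcc_of_le hlt.le] at ht
    exact hout t fun h => absurd h.2 (not_lt.mpr ht.1)

/-- The node functionals of degree one applied to a weak derivative are the node functionals
of degree zero. -/
theorem extNode1_weakDeriv {ρ : ℝ} (hρ : 0 < ρ) {u w : L2 (-ρ) (1 + ρ)}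
    (h : HasWeakDeriv (-ρ) (1 + ρ) u w) (i : Fin 3) :
    extNode1 ρ i w = extNode0 ρ i.castSucc u := by
  -- What remains for each of the three degree-one kernels is smoothness, the support condition, and
  -- that the degree-zero kernel is minus its derivative.
  refine (pairing_neg_deriv h ?_ ?_ ?_).symm
  · fin_cases i
    exacts [contDiff_etaL ρ, contDiff_etaR ρ, contDiff_cPrim ρ]
  · fin_cases i
    exacts [support_etaL hρ, support_etaR hρ, support_cPrim hρ]
  · intro x
    fin_cases i
    · rfl
    · rfl
    -- For the third functional this is the fundamental theorem of calculus: `η_r - η_l`, the kernel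
    -- of the averaged difference `u(y_r) - u(y_l)`, is minus the derivative of the primitive of
    -- `η_l - η_r`.
    · change etaR ρ x - etaL ρ x = -deriv (cPrim ρ) x
      rw [(hasDerivAt_cPrim ρ x).deriv, neg_sub]

theorem derivative_phi0_castSucc (i : Fin 3) :
    Polynomial.derivative (phi0 i.castSucc) = phi1 i := by
  apply Polynomial.funext
  intro x
  fin_cases i <;> simp [phi0, phi1] <;> ring

/-- The fourth basis function is constant, which is why the functional averaging `u(y_r) + u(y_l)`
needs no counterpart in degree one. -/
theorem derivative_phi0_last : Polynomial.derivative (phi0 (Fin.last 3)) = 0 := by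
  simp [phi0, Fin.last]

theorem sum_smulRight_apply {V W ι : Type*} [AddCommGroup V] [Module ℝ V]
    [TopologicalSpace V] [AddCommGroup W] [Module ℝ W] [TopologicalSpace W]
    [IsTopologicalAddGroup W] [ContinuousSMul ℝ W] [Fintype ι] (f : ι → V →L[ℝ] ℝ) (c : ι → W) (v : V) :
    (∑ i, (f i).smulRight (c i)) v = ∑ i, f i v • c i := by
  simp

theorem d_basis_castSucc (i : Fin 3) :
    PForm.d ⟨polyForm 0 1 0 (phi0 i.castSucc), phi0_mem _⟩
      = ⟨polyForm 0 1 1 (phi1 i), phi1_mem i⟩ := by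
  refine Subtype.ext ?_
  change polyForm 0 1 1 (Polynomial.derivative (phi0 i.castSucc)) = polyForm 0 1 1 (phi1 i)
  rw [derivative_phi0_castSucc]

theorem d_basis_last : PForm.d ⟨polyForm 0 1 0 (phi0 (Fin.last 3)), phi0_mem _⟩ = 0 := by
  refine Subtype.ext ?_
  change polyForm 0 1 1 (Polynomial.derivative (phi0 (Fin.last 3))) = 0
  rw [derivative_phi0_last, map_zero]

/-- The fourth term of the degree-zero sum is killed by `d`, and the other three match term by term,
in coefficient and in basis function. The formulation with `L2` and `PForm` keeps a function and its
weak derivative as separate variables. -/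
theorem sum_extNode_comm_d {ρ : ℝ} (hρ : 0 < ρ) {u w : L2 (-ρ) (1 + ρ)}
    (h : HasWeakDeriv (-ρ) (1 + ρ) u w) :
    (∑ i, (extNode1 ρ i).smulRight (⟨polyForm 0 1 1 (phi1 i), phi1_mem i⟩ : PForm 1)) w
      = PForm.d ((∑ i, (extNode0 ρ i).smulRight
          (⟨polyForm 0 1 0 (phi0 i), phi0_mem i⟩ : PForm 0)) u) := by
  rw [sum_smulRight_apply, sum_smulRight_apply, map_sum,
    Fin.sum_univ_castSucc (n := 3)]
  simp only [map_smul, d_basis_castSucc, d_basis_last, smul_zero, add_zero,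
    extNode1_weakDeriv hρ h]

/-- The operators `Π₀` and `Π₁` commute with the exterior derivative. -/
theorem quasiInterp_comm_d {ρ : ℝ} (hρ : 0 < ρ) (u : HLam ρ 0) :
    quasiInterp1 ρ (HLam.incl ρ 1 (HLam.d ρ u))
      = PLam.d (quasiInterp0 ρ (HLam.incl ρ 0 u)) :=
  -- An element of `HLam ρ 0` is a pair of a function and its weak derivative; the inclusion reads
  -- off the first entry, `d` moves the second into first place, and `u.2` is the weak-derivative
  -- relation between them.
  sum_extNode_comm_d hρ u.2

end OneDimCommute

/-! ### The tensor quasi-interpolation as a tensor product on each summand. -/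

section TensorCommute

/-- The operator `u ↦ Π_a u` on `HΛᵃ(I_ρ)`. -/
noncomputable def quasiInterpH (ρ : ℝ) (a : Fin 2) : HLam ρ a →L[ℝ] PLam a :=
  (quasiInterp ρ a a).comp (HLam.incl ρ a)

/-- On each summand both the inclusion and `Π^k` are tensor products of operators, so their
composite is one too. This is the form to which `map_dFactor` applies. -/
theorem tensorQuasiInterp_inclL2_apply (ρ : ℝ) {n k : ℕ} (u : HTensor ρ n k) (i : Chi n k) :
    tensorQuasiInterp ρ n k (inclL2 ρ n k u) i
      = HilbertTensor.map (fun l => quasiInterpH ρ (i.1 l)) (u i) := by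
  rw [tensorQuasiInterp, tensorOp_apply_of_diagonal]
  · change ((HilbertTensor.map fun l => quasiInterp ρ (i.1 l) (i.1 l)).comp
      (HilbertTensor.map fun l => HLam.incl ρ (i.1 l))) (u i) = _
    refine DFunLike.congr_fun (HilbertTensor.ext fun x => ?_) (u i)
    simp only [ContinuousLinearMap.comp_apply, HilbertTensor.map_pure, quasiInterpH]
  · intro a b hab
    fin_cases a <;> fin_cases b <;> first | rfl | exact absurd rfl hab

end TensorCommute

end QuasiInterp

theorem mainTheorem1 (ρ : ℝ) (hρ : 0 < ρ) (hρ' : ρ ≤ 1 / 3) (n k : ℕ)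
    (u : QuasiInterp.HTensor ρ n k) :
    QuasiInterp.tensorQuasiInterp ρ n (k + 1)
        (QuasiInterp.inclL2 ρ n (k + 1) (QuasiInterp.dH ρ n k u)) =
      QuasiInterp.dP n k
        (QuasiInterp.tensorQuasiInterp ρ n k (QuasiInterp.inclL2 ρ n k u)) := by
  -- Both sides are compared in the summand `i'` of degree `k + 1`, where they become sums over the
  -- same pairs of a source multi-index and a slot.
  funext i'
  rw [QuasiInterp.tensorQuasiInterp_inclL2_apply, QuasiInterp.dH, QuasiInterp.dP,
    QuasiInterp.tensorD_apply, QuasiInterp.tensorD_apply]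
  simp only [map_sum, map_smul, QuasiInterp.tensorQuasiInterp_inclL2_apply]
  refine Finset.sum_congr rfl fun i _ => Finset.sum_congr rfl fun j _ => ?_
  -- The sign is common to both terms, so the one-dimensional commutation, carried through the
  -- tensor factors, finishes the proof.
  rw [QuasiInterp.map_dFactor (QuasiInterp.quasiInterpH ρ)
    (QuasiInterp.quasiInterp_comm_d hρ)]
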